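/- Let $P$ be a finite set of points in the Euclidean plane. The unit disk graph $UDG(P)$ is the graph on $P$ in which two distinct points are adjacent if and only if their distance is at most $1$; assume that $UDG(P)$ is connected. A directional antenna of angle $\alpha$ and range $r$ at a point $p$ covers a closed circular sector of angle $\alpha$ of the disk of radius $r$ centered at $p$; the orientation of the sector can be chosen. Given the orientations, the induced symmetric communication graph (SCG) is the graph on $P$ in which two distinct points $u$ and $v$ are adjacent if and only if $v$ lies in the sector of $u$ and $u$ lies in the sector of $v$. Then the omni-directional antennas of range $1$ at the points of $P$ can be replaced by directional antennas of angle $\pi/2$ and range $14\sqrt{2}$, oriented in such a way that the induced SCG is (i) connected, and (ii) an $8$-spanner of $UDG(P)$ with respect to hop distance; that is, for every edge $(p,q)$ of $UDG(P)$ there is a path between $p$ and $q$ in the SCG consisting of at most $8$ edges. -/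

import Mathlib

/-- The Euclidean plane. -/
abbrev Plane : Type := EuclideanSpace ℝ (Fin 2)

/-- The unit vector of the plane in direction `φ` (an angle in radians). -/
noncomputable def unitDir (φ : ℝ) : Plane := !₂[Real.cos φ, Real.sin φ]

/-- The coverage area of a directional antenna of angle `α` and range `r` placed at `p`, whose
orientation (the direction of the bisector) is `θ`: the closed circular sector with apex `p`,
radius `r` and opening angle `α`. -/
def sector (α r : ℝ) (p : Plane) (θ : ℝ) : Set Plane :=
  {x | ∃ t φ : ℝ, 0 ≤ t ∧ t ≤ r ∧ θ - α / 2 ≤ φ ∧ φ ≤ θ + α / 2 ∧ x = p + t • unitDir φ}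

/-- The unit disk graph of a point set: distinct points at distance at most `1` are adjacent. -/
def unitDiskGraph (P : Set Plane) : SimpleGraph P where
  Adj u v := u ≠ v ∧ dist (u : Plane) (v : Plane) ≤ 1
  symm := ⟨fun _ _ h => ⟨h.1.symm, by rw [dist_comm]; exact h.2⟩⟩
  loopless := ⟨fun _ h => h.1 rfl⟩

/-- The symmetric communication graph induced by antennas of angle `α` and range `r` placed at the
points of `P`, the antenna at `p` having orientation `θ p`: two distinct points are adjacent when
each lies in the sector of the other. -/
def symmCommGraph (P : Set Plane) (α r : ℝ) (θ : P → ℝ) : SimpleGraph P where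
  Adj u v := u ≠ v ∧ (v : Plane) ∈ sector α r u (θ u) ∧ (u : Plane) ∈ sector α r v (θ v)
  symm := ⟨fun _ _ h => ⟨h.1.symm, h.2.2, h.2.1⟩⟩
  loopless := ⟨fun _ h => h.1 rfl⟩

/-- `H` is a `t`-spanner of `G` with respect to hop distance: the endpoints of every edge of `G`
are joined in `H` by a path of at most `t` hops. -/
def IsHopSpanner {V : Type*} (H G : SimpleGraph V) (t : ℕ) : Prop :=
  ∀ p q : V, G.Adj p q → ∃ w : H.Walk p q, w.IsPath ∧ w.length ≤ t

/-! Cut the plane into square cells of side 7. A cell is full if it holds at least four points of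
`P`, and sparse otherwise. Points in cells that coincide or share a side or corner are within range,
so between them only directions matter.

Four or more points contain a hub (`exists_isHub`): a path c-b-a-d of antennas whose quadrants cover
the plane, while every other point can be turned to face a or b. Two hubs separated by a line always
contain a facing pair (`IsCenter.exists_facing`), so touching full cells get linked without
coordination. Each connected component of the sparse points aims at the hub of one full cell next to
it. That hub is in range by counting (`cellsTouch_of_sparse_sequence`): a path that crosses a column
of cells makes at least seven consecutive stops in it. These occupy at most two cells, which hold at
most 3 + 3 points if sparse; hence the side 7.

In a full cell every point is within 3 hops of each hub antenna, so a sparse point is within 1 + 3 =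
4 hops of each antenna of its hub. An edge between full cells, or inside one, costs 3 + 1 + 3 = 7; a
sparse-full edge costs 4 + 1 + 3 = 8; two adjacent sparse points share a component, hence a hub, and
cost 4 + 4 = 8. If no cell is full, all of `P` is within range of itself, and a single hub or star
suffices. -/

/-! ### Quadrants and antenna sectors -/

/-- Rotation of the plane by a right angle. -/
def rot (e : Plane) : Plane := !₂[-e 1, e 0]

@[simp] theorem rot_apply_zero (e : Plane) : rot e 0 = -e 1 := rfl
@[simp] theorem rot_apply_one (e : Plane) : rot e 1 = e 0 := rfl

theorem rot_rot (e : Plane) : rot (rot e) = -e := by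
  ext i; fin_cases i <;> simp

/-- The vector `v` lies in the closed quadrant spanned by `e` and `rot e`. -/
def Wedge (e v : Plane) : Prop :=
  0 ≤ e 0 * v 0 + e 1 * v 1 ∧ 0 ≤ e 0 * v 1 - e 1 * v 0

/-- `e` has Euclidean length one. -/
def IsUnit2 (e : Plane) : Prop := e 0 ^ 2 + e 1 ^ 2 = 1

theorem IsUnit2.rot {e : Plane} (h : IsUnit2 e) : IsUnit2 (rot e) := by
  simp only [IsUnit2, rot_apply_zero, rot_apply_one] at *; linarith

theorem IsUnit2.neg {e : Plane} (h : IsUnit2 e) : IsUnit2 (-e) := by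
  simp only [IsUnit2, PiLp.neg_apply] at *; linarith

theorem plane_dist_eq (x y : Plane) : dist x y = √((x 0 - y 0) ^ 2 + (x 1 - y 1) ^ 2) := by
  simp [EuclideanSpace.dist_eq, Real.dist_eq, sq_abs]

theorem exists_isUnit2_smul {v : Plane} (hv : v ≠ 0) :
    ∃ e : Plane, IsUnit2 e ∧ ∃ r : ℝ, 0 < r ∧ v 0 = r * e 0 ∧ v 1 = r * e 1 := by
  have hpos : 0 < v 0 ^ 2 + v 1 ^ 2 := by
    by_contra! h
    apply hv
    have h0 : v 0 = 0 := by nlinarith [sq_nonneg (v 0), sq_nonneg (v 1)]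
    have h1 : v 1 = 0 := by nlinarith [sq_nonneg (v 0), sq_nonneg (v 1)]
    ext i; fin_cases i <;> simp [h0, h1]
  have hr := Real.sqrt_pos.2 hpos
  refine ⟨!₂[v 0 / √(v 0 ^ 2 + v 1 ^ 2), v 1 / √(v 0 ^ 2 + v 1 ^ 2)], ?_, _, hr, ?_, ?_⟩
  · have := Real.sq_sqrt hpos.le
    simp only [IsUnit2, Matrix.cons_val_zero, Matrix.cons_val_one, div_pow, this]
    field_simp
  · simp; field_simp
  · simp; field_simp

theorem exists_isUnit2_wedge (v : Plane) : ∃ e, IsUnit2 e ∧ Wedge e v := by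
  by_cases hv : v = 0
  · exact ⟨!₂[1, 0], by simp [IsUnit2], by simp [Wedge, hv]⟩
  · obtain ⟨e, he, r, hr, h0, h1⟩ := exists_isUnit2_smul hv
    refine ⟨e, he, ?_, ?_⟩
    · rw [h0, h1]; nlinarith [sq_nonneg (e 0), sq_nonneg (e 1)]
    · rw [h0, h1]; apply le_of_eq; ring

/-- Two vectors at an angle of at most `π / 2` lie in a common quadrant. -/
theorem exists_isUnit2_wedge_wedge (u v : Plane) (h : 0 ≤ u 0 * v 0 + u 1 * v 1) :
    ∃ e, IsUnit2 e ∧ Wedge e u ∧ Wedge e v := by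
  have key : ∀ u v : Plane, 0 ≤ u 0 * v 0 + u 1 * v 1 → 0 ≤ u 0 * v 1 - u 1 * v 0 →
      ∃ e, IsUnit2 e ∧ Wedge e u ∧ Wedge e v := by
    intro u v h h'
    by_cases hu : u = 0
    · obtain ⟨e, he, hw⟩ := exists_isUnit2_wedge v
      exact ⟨e, he, by simp [Wedge, hu], hw⟩
    · obtain ⟨e, he, r, hr, h0, h1⟩ := exists_isUnit2_smul hu
      rw [h0, h1] at h h'
      refine ⟨e, he, ⟨?_, ?_⟩, ?_, ?_⟩
      · rw [h0, h1]; nlinarith [sq_nonneg (e 0), sq_nonneg (e 1)]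
      · rw [h0, h1]; apply le_of_eq; ring
      · exact nonneg_of_mul_nonneg_right (by linarith : 0 ≤ r * (e 0 * v 0 + e 1 * v 1)) hr
      · exact nonneg_of_mul_nonneg_right (by linarith : 0 ≤ r * (e 0 * v 1 - e 1 * v 0)) hr
  rcases le_total 0 (u 0 * v 1 - u 1 * v 0) with h' | h'
  · exact key u v h h'
  · obtain ⟨e, he, h1, h2⟩ := key v u (by linarith) (by linarith)
    exact ⟨e, he, h2, h1⟩

theorem IsUnit2.exists_angle {e : Plane} (he : IsUnit2 e) :
    ∃ ψ : ℝ, e 0 = Real.cos ψ ∧ e 1 = Real.sin ψ := by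
  have hz : ‖(⟨e 0, e 1⟩ : ℂ)‖ = 1 := by
    rw [Complex.norm_def, Complex.normSq_mk, Real.sqrt_eq_one]
    unfold IsUnit2 at he; linarith
  refine ⟨Complex.arg ⟨e 0, e 1⟩, ?_, ?_⟩
  · have := Complex.norm_mul_cos_arg ⟨e 0, e 1⟩
    rw [hz] at this; simpa using this.symm
  · have := Complex.norm_mul_sin_arg ⟨e 0, e 1⟩
    rw [hz] at this; simpa using this.symm

/-- For each unit vector `e` some orientation of an antenna of angle `π / 2` makes it cover the
part within range of the quadrant spanned by `e` and `rot e`. -/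
theorem IsUnit2.exists_orientation {e : Plane} (he : IsUnit2 e) :
    ∃ θ : ℝ, ∀ (r : ℝ) (p x : Plane), Wedge e (x - p) → dist p x ≤ r →
      x ∈ sector (Real.pi / 2) r p θ := by
  obtain ⟨ψ, h0, h1⟩ := he.exists_angle
  -- The bisector is the diagonal of the quadrant. `A` and `B` are the coordinates of `x - p` in the
  -- frame of `e`, so their polar angle lies in [0, π/2].
  refine ⟨ψ + Real.pi / 4, fun r p x hw hd => ?_⟩
  obtain ⟨hw0, hw1⟩ := hw
  set A := e 0 * (x - p) 0 + e 1 * (x - p) 1 with hA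
  set B := e 0 * (x - p) 1 - e 1 * (x - p) 0 with hB
  have hn : ‖(⟨A, B⟩ : ℂ)‖ = dist p x := by
    rw [Complex.norm_def, Complex.normSq_mk, plane_dist_eq]
    congr 1
    simp only [IsUnit2] at he
    simp only [hA, hB, PiLp.sub_apply]
    linear_combination ((x 0 - p 0) ^ 2 + (x 1 - p 1) ^ 2) * he
  have hc := Complex.norm_mul_cos_arg ⟨A, B⟩
  have hs := Complex.norm_mul_sin_arg ⟨A, B⟩
  have harg0 : 0 ≤ Complex.arg ⟨A, B⟩ := Complex.arg_nonneg_iff.2 hw1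
  have harg1 : Complex.arg ⟨A, B⟩ ≤ Real.pi / 2 := Complex.arg_le_pi_div_two_iff.2 (Or.inl hw0)
  rw [hn] at hc hs
  refine ⟨dist p x, ψ + Complex.arg ⟨A, B⟩, dist_nonneg, hd, by linarith, by linarith, ?_⟩
  simp only at hc hs
  simp only [IsUnit2] at he
  ext i
  fin_cases i
  · simp only [Fin.zero_eta, PiLp.add_apply, PiLp.smul_apply, unitDir,
      Matrix.cons_val_zero, smul_eq_mul, Real.cos_add, ← h0, ← h1]
    have : x 0 - p 0 = e 0 * A - e 1 * B := by
      simp only [hA, hB, PiLp.sub_apply]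
      linear_combination (-(x 0 - p 0)) * he
    linear_combination this - e 0 * hc + e 1 * hs
  · simp only [Fin.mk_one, PiLp.add_apply, PiLp.smul_apply, unitDir,
      Matrix.cons_val_one, smul_eq_mul, Real.sin_add, ← h0, ← h1]
    have : x 1 - p 1 = e 1 * A + e 0 * B := by
      simp only [hA, hB, PiLp.sub_apply]
      linear_combination (-(x 1 - p 1)) * he
    simp only [Matrix.cons_val_fin_one]
    linear_combination this - e 1 * hc - e 0 * hs

/-! ### Centered families and facing pairs -/

/-- Some antenna of `Q`, directed by `e`, covers the point `o`. -/
def CoversFrom (D : Plane → Plane) (Q : Set Plane) (o e : Plane) : Prop :=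
  ∃ p ∈ Q, D p = e ∧ Wedge e (o - p)

/-- For each of the four directions of the frame of `e`, some antenna of `Q` in this
direction covers `o`. -/
def IsCenter (D : Plane → Plane) (Q : Set Plane) (o e : Plane) : Prop :=
  CoversFrom D Q o e ∧ CoversFrom D Q o (rot e) ∧ CoversFrom D Q o (-e) ∧
    CoversFrom D Q o (-rot e)

theorem IsCenter.rot {D : Plane → Plane} {Q : Set Plane} {o e : Plane} (h : IsCenter D Q o e) :
    IsCenter D Q o (rot e) := by
  obtain ⟨h0, h1, h2, h3⟩ := h
  refine ⟨h1, ?_, h3, ?_⟩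
  · rwa [rot_rot]
  · rwa [rot_rot, neg_neg]

theorem IsCenter.neg {D : Plane → Plane} {Q : Set Plane} {o e : Plane} (h : IsCenter D Q o e) :
    IsCenter D Q o (-e) := by
  rw [← rot_rot]; exact h.rot.rot

/-- A center has a frame one of whose quadrants contains a given direction. -/
theorem IsCenter.exists_wedge {D : Plane → Plane} {Q : Set Plane} {o e : Plane}
    (h : IsCenter D Q o e) (hD : ∀ x, IsUnit2 (D x)) (n : Plane) :
    ∃ g, IsUnit2 g ∧ IsCenter D Q o g ∧ Wedge g n := by
  have he : IsUnit2 e := by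
    obtain ⟨⟨p, -, rfl, -⟩, -⟩ := h
    exact hD p
  rcases le_total 0 (e 0 * n 0 + e 1 * n 1) with h0 | h0 <;>
  rcases le_total 0 (e 0 * n 1 - e 1 * n 0) with h1 | h1
  · exact ⟨e, he, h, h0, h1⟩
  · refine ⟨-_root_.rot e, he.rot.neg, h.rot.neg, ?_, ?_⟩ <;> simp <;> linarith
  · refine ⟨_root_.rot e, he.rot, h.rot, ?_, ?_⟩ <;> simp <;> linarith
  · refine ⟨-e, he.neg, h.neg, ?_, ?_⟩ <;> simp <;> linarith

/-- The quadrants of a centered family cover the plane. -/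
theorem IsCenter.exists_covers {D : Plane → Plane} {Q : Set Plane} {o e : Plane}
    (h : IsCenter D Q o e) (hD : ∀ x, IsUnit2 (D x)) (x : Plane) :
    ∃ p ∈ Q, Wedge (D p) (x - p) := by
  -- Both `o - p` and `x - o` lie in the quadrant of `g`, a convex cone, hence so does their sum `x
  -- - p`.
  obtain ⟨g, -, ⟨⟨p, hp, hDp, hw⟩, -⟩, hx⟩ := h.exists_wedge hD (x - o)
  refine ⟨p, hp, ?_⟩
  rw [hDp]
  obtain ⟨a, b⟩ := hw
  obtain ⟨c, d⟩ := hx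
  simp only [PiLp.sub_apply] at *
  refine ⟨?_, ?_⟩ <;> simp only [PiLp.sub_apply] <;> linarith

theorem pos_of_mul_pos_of_nonneg {a b : ℝ} (h : 0 < a * b) (ha : 0 ≤ a) : 0 < b := by
  by_contra! hb
  exact absurd h (mul_nonpos_of_nonneg_of_nonpos ha hb).not_gt

theorem sq_add_sq_pos_of_dot_pos {a b x y : ℝ} (h : 0 < a * x + b * y) : 0 < a ^ 2 + b ^ 2 := by
  by_contra! h'
  have h0 : a = 0 := by nlinarith [sq_nonneg a, sq_nonneg b]
  have h1 : b = 0 := by nlinarith [sq_nonneg a, sq_nonneg b]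
  simp [h0, h1] at h

/-- A vector having a positive product with a vector of the quadrant of `f` has a positive
component along one of the two axes of the frame of `f`. -/
theorem pos_of_dot_pos {f n : Plane} {x y : ℝ} (hf : f 0 ^ 2 + f 1 ^ 2 = 1)
    (ha : 0 ≤ f 0 * n 0 + f 1 * n 1) (hb : 0 ≤ f 0 * n 1 - f 1 * n 0)
    (hv : 0 < n 0 * x + n 1 * y) :
    (f 0 * y - f 1 * x ≤ 0 → 0 < f 0 * x + f 1 * y) ∧
      (f 0 * x + f 1 * y ≤ 0 → 0 < f 0 * y - f 1 * x) := by
  have h : n 0 * x + n 1 * y = (f 0 * n 0 + f 1 * n 1) * (f 0 * x + f 1 * y) +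
      (f 0 * n 1 - f 1 * n 0) * (f 0 * y - f 1 * x) := by
    linear_combination (-(n 0 * x + n 1 * y)) * hf
  constructor
  · intro hF
    have h2 := mul_nonpos_of_nonneg_of_nonpos hb hF
    exact pos_of_mul_pos_of_nonneg (by linarith) ha
  · intro hF
    have h2 := mul_nonpos_of_nonneg_of_nonpos ha hF
    exact pos_of_mul_pos_of_nonneg (by linarith) hb

/-- The staircase argument behind `IsCenter.exists_facing`, with the frames of the two
families ordered counterclockwise. -/
theorem exists_facing_of_cross_nonneg {D : Plane → Plane} {Q R : Set Plane} {o o' e g n : Plane}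
    (he : IsUnit2 e) (hg : IsUnit2 g)
    (hQ : IsCenter D Q o e) (hR : IsCenter D R o' (-g)) (hne : Wedge e n) (hng : Wedge g n)
    (hcr : 0 ≤ e 0 * g 1 - e 1 * g 0)
    (hsep : ∀ p ∈ Q, ∀ q ∈ R, 0 < n 0 * (q 0 - p 0) + n 1 * (q 1 - p 1)) :
    ∃ p ∈ Q, ∃ q ∈ R, Wedge (D p) (q - p) ∧ Wedge (D q) (p - q) := by
  obtain ⟨⟨pm, hpm, Dpm, spm0, spm1⟩, ⟨ph, hph, Dph, sph0, sph1⟩, -,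
    ⟨pl, hpl, Dpl, spl0, spl1⟩⟩ := hQ
  obtain ⟨⟨qm, hqm, Dqm, sqm0, sqm1⟩, ⟨qh, hqh, Dqh, sqh0, sqh1⟩, -,
    ⟨ql, hql, Dql, sql0, sql1⟩⟩ := hR
  obtain ⟨hα, hβ⟩ := hne
  obtain ⟨hγ, hδ⟩ := hng
  simp only [IsUnit2] at he hg
  simp only [PiLp.sub_apply, rot_apply_zero, rot_apply_one] at spm0 spm1 sph0 sph1
  simp only [PiLp.neg_apply, PiLp.sub_apply, rot_apply_zero, rot_apply_one] at spl0 spl1 sqm0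
  simp only [PiLp.neg_apply, PiLp.sub_apply, rot_apply_zero, rot_apply_one] at sqm1 sqh0 sqh1
  simp only [PiLp.neg_apply, PiLp.sub_apply, rot_apply_zero, rot_apply_one] at sql0 sql1
  -- Cosine and sine of the angle from `e` to `g`. The cosine is nonnegative because the quadrants
  -- of both frames contain `n`.
  set c := e 0 * g 0 + e 1 * g 1 with hc
  set s := e 0 * g 1 - e 1 * g 0 with hs
  have hn := sq_add_sq_pos_of_dot_pos (hsep pm hpm qm hqm)
  have hc0 : 0 ≤ c := by
    have : 0 ≤ (n 0 ^ 2 + n 1 ^ 2) * c := by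
      have : (n 0 ^ 2 + n 1 ^ 2) * c = (e 0 * n 0 + e 1 * n 1) * (g 0 * n 0 + g 1 * n 1) +
        (e 0 * n 1 - e 1 * n 0) * (g 0 * n 1 - g 1 * n 0) := by rw [hc]; ring
      rw [this]
      exact add_nonneg (mul_nonneg hα hγ) (mul_nonneg hβ hδ)
    exact nonneg_of_mul_nonneg_right this hn
  have relE : ∀ x y : ℝ, e 0 * x + e 1 * y = c * (g 0 * x + g 1 * y) - s * (g 0 * y - g 1 * x) := by
    intro x y
    rw [hc, hs]; linear_combination (-(e 0 * x + e 1 * y)) * hg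
  have relF : ∀ x y : ℝ, e 0 * y - e 1 * x = s * (g 0 * x + g 1 * y) + c * (g 0 * y - g 1 * x) := by
    intro x y
    rw [hc, hs]; linear_combination (-(e 0 * y - e 1 * x)) * hg
  have relG : ∀ x y : ℝ, g 0 * x + g 1 * y = c * (e 0 * x + e 1 * y) + s * (e 0 * y - e 1 * x) := by
    intro x y
    rw [hc, hs]; linear_combination (-(g 0 * x + g 1 * y)) * he
  have relH : ∀ x y : ℝ, g 0 * y - g 1 * x = c * (e 0 * y - e 1 * x) - s * (e 0 * x + e 1 * y) := by
    intro x y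
    rw [hc, hs]; linear_combination (-(g 0 * y - g 1 * x)) * he
  clear_value c s
  -- The pairs (pl, ql), (pm, ql), (pm, qm), (ph, qm), (ph, qh) are tried in turn. Each failure to
  -- face yields a strict inequality in one coordinate, which the position of the antennas relative
  -- to `o` or `o'` carries over to the next pair; the last pair cannot fail.
  by_contra! hno
  have step1 : 0 < e 0 * (ql 1 - pl 1) - e 1 * (ql 0 - pl 0) := by
    by_contra! hF
    have hv := hsep pl hpl ql hql
    have hE := (pos_of_dot_pos he hα hβ hv).1 hF
    have hH : g 0 * (ql 1 - pl 1) - g 1 * (ql 0 - pl 0) ≤ 0 := by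
      rw [relH]
      have := mul_nonneg hcr hE.le
      have := mul_nonpos_of_nonneg_of_nonpos hc0 hF
      linarith
    have hG := (pos_of_dot_pos hg hγ hδ hv).1 hH
    apply hno pl hpl ql hql <;> (try rw [Dpl]) <;> (try rw [Dql]) <;>
      simp only [Wedge, PiLp.sub_apply, PiLp.neg_apply, rot_apply_zero, rot_apply_one] <;>
      constructor <;> linarith
  have step2 : 0 < g 0 * (ql 1 - pm 1) - g 1 * (ql 0 - pm 0) := by
    by_contra! hH
    have hv := hsep pm hpm ql hql
    have hG := (pos_of_dot_pos hg hγ hδ hv).1 hH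
    have hE : 0 ≤ e 0 * (ql 0 - pm 0) + e 1 * (ql 1 - pm 1) := by
      rw [relE]
      have := mul_nonneg hc0 hG.le
      have := mul_nonpos_of_nonneg_of_nonpos hcr hH
      linarith
    apply hno pm hpm ql hql <;> (try rw [Dpm]) <;> (try rw [Dql]) <;>
      simp only [Wedge, PiLp.sub_apply, PiLp.neg_apply, rot_apply_zero, rot_apply_one] <;>
      constructor <;> linarith
  have step3 : e 0 * (qm 0 - pm 0) + e 1 * (qm 1 - pm 1) < 0 := by
    by_contra! hE
    have hH : 0 < g 0 * (qm 1 - pm 1) - g 1 * (qm 0 - pm 0) := by linarith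
    have hF : 0 ≤ e 0 * (qm 1 - pm 1) - e 1 * (qm 0 - pm 0) := by
      rw [relH] at hH
      have := mul_nonneg hcr hE
      exact (pos_of_mul_pos_of_nonneg (by linarith) hc0).le
    have hG : 0 ≤ g 0 * (qm 0 - pm 0) + g 1 * (qm 1 - pm 1) := by
      rw [relG]; positivity
    apply hno pm hpm qm hqm <;> (try rw [Dpm]) <;> (try rw [Dqm]) <;>
      simp only [Wedge, PiLp.sub_apply, PiLp.neg_apply] <;>
      constructor <;> linarith
  have step4 : g 0 * (qm 0 - ph 0) + g 1 * (qm 1 - ph 1) < 0 := by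
    by_contra! hG
    have hv := hsep ph hph qm hqm
    have hE : e 0 * (qm 0 - ph 0) + e 1 * (qm 1 - ph 1) < 0 := by linarith
    have hF := (pos_of_dot_pos he hα hβ hv).2 hE.le
    have hH : 0 ≤ g 0 * (qm 1 - ph 1) - g 1 * (qm 0 - ph 0) := by
      rw [relH]
      have := mul_nonneg hc0 hF.le
      have := mul_nonpos_of_nonneg_of_nonpos hcr hE.le
      linarith
    apply hno ph hph qm hqm <;> (try rw [Dph]) <;> (try rw [Dqm]) <;>
      simp only [Wedge, PiLp.sub_apply, PiLp.neg_apply, rot_apply_zero, rot_apply_one] <;>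
      constructor <;> linarith
  have hv := hsep ph hph qh hqh
  have hG : g 0 * (qh 0 - ph 0) + g 1 * (qh 1 - ph 1) < 0 := by linarith
  have hH := (pos_of_dot_pos hg hγ hδ hv).2 hG.le
  have hE : e 0 * (qh 0 - ph 0) + e 1 * (qh 1 - ph 1) ≤ 0 := by
    rw [relE]
    have := mul_nonneg hcr hH.le
    have := mul_nonpos_of_nonneg_of_nonpos hc0 hG.le
    linarith
  have hF := (pos_of_dot_pos he hα hβ hv).2 hE
  apply hno ph hph qh hqh <;> (try rw [Dph]) <;> (try rw [Dqh]) <;>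
    simp only [Wedge, PiLp.sub_apply, PiLp.neg_apply, rot_apply_zero, rot_apply_one] <;>
    constructor <;> linarith

/-- Two centered families separated by a line contain antennas that cover each other. -/
theorem IsCenter.exists_facing {D : Plane → Plane} {Q R : Set Plane} {o o' e g : Plane}
    (hQ : IsCenter D Q o e) (hR : IsCenter D R o' g) (hD : ∀ x, IsUnit2 (D x)) (n : Plane)
    (hsep : ∀ p ∈ Q, ∀ q ∈ R, 0 < n 0 * (q 0 - p 0) + n 1 * (q 1 - p 1)) :
    ∃ p ∈ Q, ∃ q ∈ R, Wedge (D p) (q - p) ∧ Wedge (D q) (p - q) := by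
  obtain ⟨e, he, hQ, hne⟩ := hQ.exists_wedge hD n
  obtain ⟨g, hg, hR, hng⟩ := hR.exists_wedge hD (-n)
  have hng' : Wedge (-g) n := by
    obtain ⟨a, b⟩ := hng
    simp only [PiLp.neg_apply] at a b
    constructor <;> simp only [PiLp.neg_apply] <;> linarith
  have hne' : Wedge (-e) (-n) := by
    obtain ⟨a, b⟩ := hne
    constructor <;> simp only [PiLp.neg_apply] <;> linarith
  -- Exchanging the two families and reversing `n` changes the sign of the cross product.
  rcases le_total 0 (e 0 * (-g) 1 - e 1 * (-g) 0) with h | h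
  · exact exists_facing_of_cross_nonneg he hg.neg hQ (by rwa [neg_neg]) hne hng' h hsep
  · obtain ⟨q, hq, p, hp, h1, h2⟩ := exists_facing_of_cross_nonneg hg he.neg hR
      (by rwa [neg_neg]) hng hne' (by simp only [PiLp.neg_apply] at *; linarith)
      (fun q hq p hp => by
        have := hsep p hp q hq
        simp only [PiLp.neg_apply]; linarith)
    exact ⟨p, hp, q, hq, h2, h1⟩

/-! ### Supporting lines of finite sets -/

/-- Scalar product of `u - a` and `v - a`. -/
def dotFrom (a u v : Plane) : ℝ := (u 0 - a 0) * (v 0 - a 0) + (u 1 - a 1) * (v 1 - a 1)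

/-- Cross product of `u - a` and `v - a`. -/
def crossFrom (a u v : Plane) : ℝ := (u 0 - a 0) * (v 1 - a 1) - (u 1 - a 1) * (v 0 - a 0)

theorem dotFrom_self_pos {a u : Plane} (h : u ≠ a) : 0 < dotFrom a u u := by
  unfold dotFrom
  by_contra! h'
  apply h
  have h0 : u 0 - a 0 = 0 := by nlinarith [sq_nonneg (u 0 - a 0), sq_nonneg (u 1 - a 1)]
  have h1 : u 1 - a 1 = 0 := by nlinarith [sq_nonneg (u 0 - a 0), sq_nonneg (u 1 - a 1)]
  ext i; fin_cases i
  · simpa using sub_eq_zero.1 h0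
  · simpa using sub_eq_zero.1 h1

/-- Among finitely many points in an open half-plane bounded by a line through `a`, one is the
first in the counterclockwise order around `a`. -/
theorem exists_crossFrom_nonneg {V : Finset Plane} (hV : V.Nonempty) (a n : Plane)
    (h : ∀ x ∈ V, 0 < dotFrom a n x) : ∃ m ∈ V, ∀ x ∈ V, 0 ≤ crossFrom a m x := by
  -- The quotient is the tangent of the angle at `a` from `n` to `x`, which is monotone on the
  -- half-plane.
  obtain ⟨m, hm, hmin⟩ := V.exists_min_image (fun x => crossFrom a n x / dotFrom a n x) hV
  refine ⟨m, hm, fun x hx => ?_⟩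
  have h1 := (div_le_div_iff₀ (h m hm) (h x hx)).1 (hmin x hx)
  have hn : 0 < dotFrom a n n := by
    apply dotFrom_self_pos
    rintro rfl
    simpa [dotFrom] using h m hm
  have h2 : dotFrom a n n * crossFrom a m x =
      crossFrom a n x * dotFrom a n m - crossFrom a n m * dotFrom a n x := by
    simp only [dotFrom, crossFrom]; ring
  exact nonneg_of_mul_nonneg_right (by linarith) hn

/-- Among finitely many points in an open half-plane bounded by a line through `a`, one is the
last in the counterclockwise order around `a`. -/
theorem exists_crossFrom_nonpos {V : Finset Plane} (hV : V.Nonempty) (a n : Plane)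
    (h : ∀ x ∈ V, 0 < dotFrom a n x) : ∃ m ∈ V, ∀ x ∈ V, crossFrom a m x ≤ 0 := by
  obtain ⟨m, hm, hmax⟩ := V.exists_max_image (fun x => crossFrom a n x / dotFrom a n x) hV
  refine ⟨m, hm, fun x hx => ?_⟩
  have h1 := (div_le_div_iff₀ (h x hx) (h m hm)).1 (hmax x hx)
  have hn : 0 < dotFrom a n n := by
    apply dotFrom_self_pos
    rintro rfl
    simpa [dotFrom] using h m hm
  have h2 : dotFrom a n n * crossFrom a m x =
      crossFrom a n x * dotFrom a n m - crossFrom a n m * dotFrom a n x := by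
    simp only [dotFrom, crossFrom]; ring
  exact nonpos_of_mul_nonpos_right (by linarith) hn

/-- `S` lies on the left of the line through its points `a` and `b`. -/
def Supports (S : Finset Plane) (a b : Plane) : Prop :=
  a ∈ S ∧ b ∈ S ∧ a ≠ b ∧ ∀ x ∈ S, 0 ≤ crossFrom a b x

/-- A point `a` farthest from the origin is extreme: all other points lie strictly on the origin's
side of the line through `a` orthogonal to its position vector. The first of them counterclockwise
around `a` serves as `b`. -/
theorem exists_supports {S : Finset Plane} (hS : 2 ≤ S.card) : ∃ a b, Supports S a b := by
  have hne : S.Nonempty := Finset.card_pos.1 (by omega)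
  obtain ⟨a, ha, hmax⟩ := S.exists_max_image (fun x => x 0 ^ 2 + x 1 ^ 2) hne
  have hV : (S.erase a).Nonempty := Finset.card_pos.1 (by rw [Finset.card_erase_of_mem ha]; omega)
  obtain ⟨b, hb, hbx⟩ := exists_crossFrom_nonneg hV a 0 (by
    intro x hx
    have h1 := dotFrom_self_pos (Finset.ne_of_mem_erase hx)
    have h2 := hmax x (Finset.mem_of_mem_erase hx)
    simp only [dotFrom, PiLp.zero_apply] at *
    nlinarith)
  refine ⟨a, b, ha, Finset.mem_of_mem_erase hb, (Finset.ne_of_mem_erase hb).symm, fun x hx => ?_⟩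
  by_cases hxa : x = a
  · simp [crossFrom, hxa]
  · exact hbx x (Finset.mem_erase.2 ⟨hxa, hx⟩)

/-- A longest supporting pair `a`, `b`: the other points project neither all beyond `b` nor all
before `a`. -/
theorem exists_supports_longest {S : Finset Plane} (hS : 3 ≤ S.card) :
    ∃ a b, Supports S a b ∧
      (∃ c ∈ S, c ≠ a ∧ c ≠ b ∧ dotFrom a b c ≤ dotFrom a b b) ∧
      ∃ d ∈ S, d ≠ a ∧ d ≠ b ∧ 0 ≤ dotFrom a b d := by
  classical
  obtain ⟨a₀, b₀, h₀⟩ := exists_supports (S := S) (by omega)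
  obtain ⟨⟨a, b⟩, hab, hmax⟩ := ((S ×ˢ S).filter fun p => Supports S p.1 p.2).exists_max_image
    (fun p => dotFrom p.1 p.2 p.2) ⟨(a₀, b₀), by simp [h₀, h₀.1, h₀.2.1]⟩
  have hmax : ∀ x y, Supports S x y → dotFrom x y y ≤ dotFrom a b b := fun x y h =>
    hmax (x, y) (by simp [h, h.1, h.2.1])
  have hab : Supports S a b := (Finset.mem_filter.1 hab).2
  have hV : ((S.erase a).erase b).Nonempty := by
    apply Finset.card_pos.1
    have := Finset.pred_card_le_card_erase (s := S.erase a) (a := b)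
    rw [Finset.card_erase_of_mem hab.1] at this
    omega
  have hbb := dotFrom_self_pos hab.2.2.1.symm
  have hVmem : ∀ x ∈ (S.erase a).erase b, x ∈ S ∧ x ≠ a ∧ x ≠ b := by
    intro x hx
    simp only [Finset.mem_erase] at hx
    exact ⟨hx.2.2, hx.2.1, hx.1⟩
  have hVcases : ∀ x ∈ S, x = a ∨ x = b ∨ x ∈ (S.erase a).erase b := by
    intro x hx
    simp only [Finset.mem_erase]
    tauto
  refine ⟨a, b, hab, ?_, ?_⟩
  · by_contra! hno
    -- If all other points project beyond `b`, the last one `m` counterclockwise around `a` gives a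
    -- supporting pair `m`, `a`. It is longer than `a`, `b`, since its projection already is. The
    -- second half is the mirror image.
    have hlt : ∀ x ∈ (S.erase a).erase b, dotFrom a b b < dotFrom a b x := fun x hx =>
      hno x (hVmem x hx).1 (hVmem x hx).2.1 (hVmem x hx).2.2
    obtain ⟨m, hm, hmx⟩ := exists_crossFrom_nonpos hV a b (fun x hx => hbb.trans (hlt x hx))
    have hsup : Supports S m a := by
      refine ⟨(hVmem m hm).1, hab.1, (hVmem m hm).2.1, fun x hx => ?_⟩
      have : crossFrom m a x = -crossFrom a m x := by simp only [crossFrom]; ring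
      rw [this]
      rcases hVcases x hx with rfl | rfl | hx'
      · simp [crossFrom]
      · have := hab.2.2.2 m (hVmem m hm).1
        simp only [crossFrom] at this ⊢
        linarith
      · linarith [hmx x hx']
    have h1 := hmax _ _ hsup
    have h2 := hlt m hm
    have h3 : 0 ≤ dotFrom b m m := by unfold dotFrom; nlinarith
    simp only [dotFrom] at *
    nlinarith
  · by_contra! hno
    have hlt : ∀ x ∈ (S.erase a).erase b, dotFrom a b x < 0 := fun x hx =>
      hno x (hVmem x hx).1 (hVmem x hx).2.1 (hVmem x hx).2.2
    obtain ⟨m, hm, hmx⟩ := exists_crossFrom_nonneg hV b a (fun x hx => by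
      have := hlt x hx
      simp only [dotFrom] at *
      nlinarith)
    have hsup : Supports S b m := by
      refine ⟨hab.2.1, (hVmem m hm).1, (hVmem m hm).2.2.symm, fun x hx => ?_⟩
      rcases hVcases x hx with rfl | rfl | hx'
      · have := hab.2.2.2 m (hVmem m hm).1
        simp only [crossFrom] at this ⊢
        linarith
      · simp [crossFrom]
      · exact hmx x hx'
    have h1 := hmax _ _ hsup
    have h2 := hlt m hm
    have h3 : 0 ≤ dotFrom a m m := by unfold dotFrom; nlinarith
    simp only [dotFrom] at *
    nlinarith

/-! ### Hubs and stars -/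

/-- The antennas at `u` and `v`, of unbounded range, cover each other. -/
def Facing (D : Plane → Plane) (u v : Plane) : Prop :=
  u ≠ v ∧ Wedge (D u) (v - u) ∧ Wedge (D v) (u - v)

theorem Facing.symm {D : Plane → Plane} {u v : Plane} (h : Facing D u v) : Facing D v u :=
  ⟨h.1.symm, h.2.2, h.2.1⟩

/-- The directions `D` make `b - a - d` and `b - c` facing pairs, with the quadrants of `a`, `b`,
`c`, `d` covering the plane, and make every other point of `S` face `a` or `b`. -/
structure IsHub (S : Set Plane) (D : Plane → Plane) (a b c d : Plane) : Prop where
  subset : {a, b, c, d} ⊆ S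
  facing_ab : Facing D a b
  facing_ad : Facing D a d
  facing_bc : Facing D b c
  attached : ∀ p ∈ S, p ∈ ({a, b, c, d} : Set Plane) ∨ Facing D p a ∨ Facing D p b
  isCenter : ∃ o e, IsCenter D {a, b, c, d} o e

/-- Draw the line through a longest supporting pair horizontally, with `a` on the left, `b` on the
right and all points on or above it. Let `a` look up-right, `b` up-left, `c` down-right and `d`
down-left. Then `a` and `b` together cover the upper half-plane, hence all of `S`. The bounds on the
projections make `c` face `b` and `d` face `a`; with `c` not to the right of `d`, no gap remains
below. -/
theorem exists_isHub {S : Finset Plane} (hS : 4 ≤ S.card) :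
    ∃ (D : Plane → Plane) (a b c d : Plane), (∀ x, IsUnit2 (D x)) ∧ IsHub S D a b c d := by
  classical
  obtain ⟨a, b, ⟨ha, hb, hab, hsup⟩, ⟨c, hcS, hca, hcb, hc⟩, ⟨d, hdS, hda, hdb, hd⟩⟩ :=
    exists_supports_longest (S := S) (by omega)
  -- The two points may coincide; a fourth point then replaces one of them. Ordering them by
  -- projection preserves both bounds.
  obtain ⟨c, d, hcS, hca, hcb, hc, hdS, hda, hdb, hd, hcd, hle⟩ : ∃ c d : Plane,
      c ∈ S ∧ c ≠ a ∧ c ≠ b ∧ dotFrom a b c ≤ dotFrom a b b ∧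
      d ∈ S ∧ d ≠ a ∧ d ≠ b ∧ 0 ≤ dotFrom a b d ∧ c ≠ d ∧ dotFrom a b c ≤ dotFrom a b d := by
    by_cases hcd : c = d
    · subst hcd
      obtain ⟨x, hxS, hxc, hxa, hxb⟩ : ∃ x ∈ S, x ≠ c ∧ x ≠ a ∧ x ≠ b := by
        by_contra! h
        have : S ⊆ {c, a, b} := by
          intro x hx
          simp only [Finset.mem_insert, Finset.mem_singleton]
          have := h x hx
          tauto
        have := Finset.card_le_card this
        have := Finset.card_le_three (a := c) (b := a) (c := b)
        omega
      rcases le_total (dotFrom a b c) (dotFrom a b x) with h | h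
      · exact ⟨c, x, hcS, hca, hcb, hc, hxS, hxa, hxb, hd.trans h, hxc.symm, h⟩
      · exact ⟨x, c, hxS, hxa, hxb, h.trans hc, hcS, hca, hcb, hd, hxc, h⟩
    · rcases le_total (dotFrom a b c) (dotFrom a b d) with h | h
      · exact ⟨c, d, hcS, hca, hcb, hc, hdS, hda, hdb, hd, hcd, h⟩
      · exact ⟨d, c, hdS, hda, hdb, h.trans hc, hcS, hca, hcb, hd.trans h, Ne.symm hcd, h⟩
  obtain ⟨e, he, r, hr, hr0, hr1⟩ := exists_isUnit2_smul (sub_ne_zero.2 hab.symm)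
  simp only [PiLp.sub_apply] at hr0 hr1
  have hdot : ∀ x, dotFrom a b x = r * (e 0 * (x 0 - a 0) + e 1 * (x 1 - a 1)) := by
    intro x; simp only [dotFrom, hr0, hr1]; ring
  have hcross : ∀ x ∈ S, 0 ≤ e 0 * (x 1 - a 1) - e 1 * (x 0 - a 0) := by
    intro x hx
    have h := hsup x hx
    have : crossFrom a b x = r * (e 0 * (x 1 - a 1) - e 1 * (x 0 - a 0)) := by
      simp only [crossFrom, hr0, hr1]; ring
    rw [this] at h
    exact nonneg_of_mul_nonneg_right h hr
  rw [hdot, hdot, mul_le_mul_iff_right₀ hr] at hc hle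
  rw [hdot] at hd
  have hd := nonneg_of_mul_nonneg_right hd hr
  have hbe : e 0 * (b 0 - a 0) + e 1 * (b 1 - a 1) = r := by
    rw [hr0, hr1]; unfold IsUnit2 at he; linear_combination r * he
  have hbe' : e 0 * (b 1 - a 1) - e 1 * (b 0 - a 0) = 0 := by
    rw [hr0, hr1]; ring
  choose f hf hfw using exists_isUnit2_wedge
  have hcc := hcross c hcS
  have hdd := hcross d hdS
  rw [hbe] at hc
  clear hr0 hr1 hdot hsup
  let D : Plane → Plane := fun x => if x = a then e else if x = b then rot e else
    if x = c then -rot e else if x = d then -e else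
    if Wedge e (x - a) then f (a - x) else f (b - x)
  have hDa : D a = e := by simp [D]
  have hDb : D b = rot e := by simp [D, hab.symm]
  have hDc : D c = -rot e := by simp [D, hca, hcb]
  have hDd : D d = -e := by simp [D, hda, hdb, hcd.symm]
  refine ⟨D, a, b, c, d, ?_, ?_, ?_, ?_, ?_, ?_, ?_⟩
  · intro x
    simp only [D]
    split_ifs
    exacts [he, he.rot, he.rot.neg, he.neg, hf _, hf _]
  · rintro x (rfl | rfl | rfl | rfl) <;> assumption
  · refine ⟨hab, ?_, ?_⟩
    · rw [hDa]; constructor <;> simp only [PiLp.sub_apply] <;> linarith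
    · rw [hDb]; constructor <;> simp only [PiLp.sub_apply, rot_apply_zero, rot_apply_one] <;> linarith
  · refine ⟨hda.symm, ?_, ?_⟩
    · rw [hDa]; constructor <;> simp only [PiLp.sub_apply] <;> linarith
    · rw [hDd]; constructor <;> simp only [PiLp.sub_apply, PiLp.neg_apply] <;> linarith
  · refine ⟨hcb.symm, ?_, ?_⟩
    · rw [hDb]; constructor <;> simp only [PiLp.sub_apply, rot_apply_zero, rot_apply_one] <;> linarith
    · rw [hDc]; constructor <;>
        simp only [PiLp.sub_apply, PiLp.neg_apply, rot_apply_zero, rot_apply_one] <;> linarith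
  · intro p hp
    by_cases hpQ : p ∈ ({a, b, c, d} : Set Plane)
    · exact Or.inl hpQ
    right
    simp only [Set.mem_insert_iff, Set.mem_singleton_iff, not_or] at hpQ
    obtain ⟨hpa, hpb, hpc, hpd⟩ := hpQ
    have hpp := hcross p hp
    by_cases hw : Wedge e (p - a)
    · left
      refine ⟨hpa, ?_, by rwa [hDa]⟩
      have : D p = f (a - p) := by simp [D, hpa, hpb, hpc, hpd, hw]
      rw [this]; exact hfw _
    · right
      refine ⟨hpb, ?_, ?_⟩
      · have : D p = f (b - p) := by simp [D, hpa, hpb, hpc, hpd, hw]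
        rw [this]; exact hfw _
      · have hneg : e 0 * (p 0 - a 0) + e 1 * (p 1 - a 1) < 0 := by
          by_contra! h
          exact hw ⟨h, hpp⟩
        rw [hDb]; constructor <;> simp only [PiLp.sub_apply, rot_apply_zero, rot_apply_one] <;>
          linarith
  -- The center lies on the line `a b`, at an abscissa `t` that must be at least those of `a` and
  -- `c` and at most those of `b` and `d`.
  · set t := max 0 (e 0 * (c 0 - a 0) + e 1 * (c 1 - a 1)) with ht
    have ht0 : 0 ≤ t := le_max_left _ _
    have htc : e 0 * (c 0 - a 0) + e 1 * (c 1 - a 1) ≤ t := le_max_right _ _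
    have htb : t ≤ r := max_le hr.le hc
    have htd : t ≤ e 0 * (d 0 - a 0) + e 1 * (d 1 - a 1) := max_le hd hle
    clear_value t
    have h0 : e 0 * (t * e 0) + e 1 * (t * e 1) = t := by
      unfold IsUnit2 at he; linear_combination t * he
    have h1 : e 0 * (t * e 1) - e 1 * (t * e 0) = 0 := by ring
    refine ⟨a + t • e, e, ⟨a, by simp, hDa, ?_⟩, ⟨b, by simp, hDb, ?_⟩, ⟨d, by simp, hDd, ?_⟩,
      ⟨c, by simp, hDc, ?_⟩⟩ <;> constructor <;>
      simp only [PiLp.sub_apply, PiLp.add_apply, PiLp.smul_apply, smul_eq_mul, PiLp.neg_apply,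
        rot_apply_zero, rot_apply_one] <;> linarith

/-- At most three points can be directed so that they all face one of them. -/
theorem exists_star (u v w : Plane) :
    ∃ (D : Plane → Plane) (a : Plane), (∀ x, IsUnit2 (D x)) ∧ a ∈ ({u, v, w} : Set Plane) ∧
      ∀ p ∈ ({u, v, w} : Set Plane), p = a ∨ Facing D p a := by
  classical
  have key : ∀ a b c : Plane, 0 ≤ dotFrom a b c →
      ∃ (D : Plane → Plane), (∀ x, IsUnit2 (D x)) ∧
        ∀ p ∈ ({a, b, c} : Set Plane), p = a ∨ Facing D p a := by
    intro a b c h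
    choose f hf hfw using exists_isUnit2_wedge
    obtain ⟨e, he, hb, hc⟩ := exists_isUnit2_wedge_wedge (b - a) (c - a) h
    refine ⟨fun x => if x = a then e else f (a - x), ?_, ?_⟩
    · intro x
      dsimp only
      split_ifs
      exacts [he, hf _]
    · intro p hp
      by_cases hpa : p = a
      · exact Or.inl hpa
      refine Or.inr ⟨hpa, ?_, ?_⟩
      · simp only [if_neg hpa]; exact hfw _
      · simp only [if_true]
        rcases hp with rfl | rfl | rfl
        exacts [absurd rfl hpa, hb, hc]
  by_cases h1 : 0 ≤ dotFrom u v w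
  · obtain ⟨D, hD, h⟩ := key u v w h1
    exact ⟨D, u, hD, by simp, h⟩
  -- The scalar products at `u` and `v` sum to the squared distance of `u` and `v`, so they are not
  -- both negative.
  · have h2 : 0 ≤ dotFrom v u w := by
      simp only [dotFrom] at *
      nlinarith [sq_nonneg (u 0 - v 0), sq_nonneg (u 1 - v 1)]
    obtain ⟨D, hD, h⟩ := key v u w h2
    refine ⟨D, v, hD, by simp, fun p hp => h p ?_⟩
    simp only [Set.mem_insert_iff, Set.mem_singleton_iff] at *
    tauto

/-! ### The square grid and paths through sparse cells -/

theorem abs_apply_sub_le_dist (x y : Plane) (i : Fin 2) : |x i - y i| ≤ dist x y := by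
  rw [plane_dist_eq]
  apply Real.abs_le_sqrt
  revert i
  rw [Fin.forall_fin_two]
  exact ⟨le_add_of_nonneg_right (sq_nonneg _), le_add_of_nonneg_left (sq_nonneg _)⟩

/-- The cell of the square grid of side `7` containing a point. -/
noncomputable def cell (p : Plane) (i : Fin 2) : ℤ := ⌊p i / 7⌋

theorem le_cell {p : Plane} {i : Fin 2} {m : ℤ} : m ≤ cell p i ↔ 7 * (m : ℝ) ≤ p i := by
  rw [cell, Int.le_floor, le_div_iff₀ (by norm_num), mul_comm]

theorem cell_lt {p : Plane} {i : Fin 2} {m : ℤ} : cell p i < m ↔ p i < 7 * (m : ℝ) := by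
  rw [← not_le, le_cell, not_le]

/-- The cells of `p` and `q` coincide or share a side or a corner. -/
def CellsTouch (p q : Plane) : Prop := ∀ i, |cell p i - cell q i| ≤ 1

theorem CellsTouch.symm {p q : Plane} (h : CellsTouch p q) : CellsTouch q p := fun i => by
  rw [abs_sub_comm]; exact h i

theorem cellsTouch_of_dist_le_one {p q : Plane} (h : dist p q ≤ 1) : CellsTouch p q := by
  intro i
  have h1 := abs_le.1 ((abs_apply_sub_le_dist p q i).trans h)
  rw [abs_le]
  constructor
  · by_contra! h2
    have h3 : cell p i < cell q i - 1 := by linarith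
    have h4 := cell_lt.1 h3
    have h5 := le_cell.1 (le_refl (cell q i))
    push_cast at h4
    linarith
  · by_contra! h2
    have h3 : cell q i < cell p i - 1 := by linarith
    have h4 := cell_lt.1 h3
    have h5 := le_cell.1 (le_refl (cell p i))
    push_cast at h4
    linarith

/-- Two touching cells fit in a square of side 14, whose diagonal is the range of the antennas. -/
theorem CellsTouch.dist_le {p q : Plane} (h : CellsTouch p q) : dist p q ≤ 14 * √2 := by
  have key : ∀ i, (p i - q i) ^ 2 ≤ 14 ^ 2 := by
    intro i
    have h1 := abs_le.1 (h i)
    have h2 := cell_lt.1 (lt_add_one (cell p i))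
    have h3 := le_cell.1 (le_refl (cell p i))
    have h4 := cell_lt.1 (lt_add_one (cell q i))
    have h5 := le_cell.1 (le_refl (cell q i))
    have h6 : (-1 : ℝ) ≤ cell p i - cell q i := by exact_mod_cast h1.1
    have h7 : (cell p i - cell q i : ℝ) ≤ 1 := by exact_mod_cast h1.2
    push_cast at h2 h4
    exact sq_le_sq' (by linarith) (by linarith)
  rw [plane_dist_eq]
  apply Real.sqrt_le_iff.2 ⟨by positivity, ?_⟩
  rw [mul_pow, Real.sq_sqrt (by norm_num)]
  linarith [key 0, key 1]

theorem CellsTouch.of_cell_eq {p q p' q' : Plane} (h : CellsTouch p q) (hp : cell p' = cell p)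
    (hq : cell q' = cell q) : CellsTouch p' q' := fun i => by rw [hp, hq]; exact h i

/-- A sequence with steps of length at most one takes seven consecutive values in each
column (or row) of cells that it crosses. -/
theorem exists_crossing_of_lt {z : ℕ → Plane} {a b : ℕ} (hab : a ≤ b)
    (hstep : ∀ j, a ≤ j → j < b → dist (z j) (z (j + 1)) ≤ 1) {i : Fin 2} {m : ℤ}
    (ha : cell (z a) i < m) (hb : m < cell (z b) i) :
    ∃ s, a ≤ s ∧ s + 8 ≤ b ∧ ∀ j, s < j → j < s + 8 → cell (z j) i = m := by
  classical
  -- `s` is the last index before the column and `t` the first later index beyond it. Cells are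
  -- half-open, so the displacement strictly exceeds 7 and `t` is at least `s + 8`.
  obtain ⟨s, hs, hsmax⟩ := ((Finset.Icc a b).filter fun j => cell (z j) i < m).exists_max_image id
    ⟨a, by simp [hab, ha]⟩
  simp only [Finset.mem_filter, Finset.mem_Icc, id] at hs hsmax
  obtain ⟨t, ht, htmin⟩ := ((Finset.Icc s b).filter fun j => m < cell (z j) i).exists_min_image id
    ⟨b, by simp [hs.1.2, hb]⟩
  simp only [Finset.mem_filter, Finset.mem_Icc, id] at ht htmin
  have hlen : ∀ k, s + k ≤ b → z (s + k) i - z s i ≤ k := by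
    intro k
    induction k with
    | zero => simp
    | succ k ih =>
      intro hk
      have h1 := ih (by omega)
      have h2 := abs_le.1 ((abs_apply_sub_le_dist _ _ i).trans (hstep (s + k) (by omega) (by omega)))
      rw [← add_assoc]
      push_cast
      linarith
  have h8 : s + 8 ≤ t := by
    have h1 := hlen (t - s) (by omega)
    rw [Nat.add_sub_cancel' ht.1.1, Nat.cast_sub ht.1.1] at h1
    have h2 := cell_lt.1 hs.2
    have h3 := le_cell.1 (Int.add_one_le_iff.2 ht.2)
    push_cast at h3
    by_contra! h
    have : (t : ℝ) ≤ s + 7 := by exact_mod_cast Nat.lt_succ_iff.1 h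
    linarith
  refine ⟨s, hs.1.1, by omega, fun j hj hj' => le_antisymm ?_ ?_⟩
  · by_contra! h
    have := htmin j ⟨⟨by omega, by omega⟩, h⟩
    omega
  · by_contra! h
    have := hsmax j ⟨⟨by omega, by omega⟩, h⟩
    omega

theorem exists_crossing {z : ℕ → Plane} {a b : ℕ} (hab : a ≤ b)
    (hstep : ∀ j, a ≤ j → j < b → dist (z j) (z (j + 1)) ≤ 1) {i : Fin 2}
    (h : 1 < |cell (z a) i - cell (z b) i|) :
    ∃ m s, a ≤ s ∧ s + 8 ≤ b ∧ ∀ j, s < j → j < s + 8 → cell (z j) i = m := by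
  rcases lt_abs.1 h with h | h
  -- The sequence is reversed by `j ↦ a + b - j`.
  · obtain ⟨s, h1, h2, h3⟩ := exists_crossing_of_lt (z := fun j => z (a + b - j)) (a := a) (b := b)
      (i := i) (m := cell (z b) i + 1) hab (by
        intro j hj hj'
        have := hstep (a + b - (j + 1)) (by omega) (by omega)
        rw [dist_comm]
        rwa [show a + b - (j + 1) + 1 = a + b - j by omega] at this)
      (by simp) (by simp only [Nat.add_sub_cancel]; linarith)
    refine ⟨cell (z b) i + 1, a + b - (s + 8), by omega, by omega, fun j hj hj' => ?_⟩
    have := h3 (a + b - j) (by omega) (by omega)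
    rwa [show a + b - (a + b - j) = j by omega] at this
  · exact ⟨_, exists_crossing_of_lt (m := cell (z a) i + 1) hab hstep (by linarith) (by linarith)⟩

open Classical in
/-- The number of points of `P` in the cell of `x`. -/
noncomputable def cellCard (P : Finset Plane) (x : Plane) : ℕ :=
  (P.filter fun y => cell y = cell x).card

theorem card_le_of_cell_eq {P : Finset Plane} {z : ℕ → Plane} {I : Finset ℕ} {j₀ : ℕ}
    (hP : ∀ j ∈ I, z j ∈ P) (hinj : Set.InjOn z I) (hcell : ∀ j ∈ I, cell (z j) = cell (z j₀)) :
    I.card ≤ cellCard P (z j₀) := by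
  classical
  rw [cellCard]
  refine Finset.card_le_card_of_injOn z (fun j hj => ?_) hinj
  simp [hP j hj, hcell j hj]

theorem exists_other_coordinate (i : Fin 2) : ∃ i', ∀ j : Fin 2, j = i ∨ j = i' := by
  fin_cases i
  · exact ⟨1, by decide⟩
  · exact ⟨0, by decide⟩

/-- A path of sparse cells that stays in one column of cells visits only cells that touch. -/
theorem abs_cell_sub_le_one_of_column {P : Finset Plane} {z : ℕ → Plane} {a b : ℕ} (hab : a ≤ b)
    (hstep : ∀ j, a ≤ j → j < b → dist (z j) (z (j + 1)) ≤ 1)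
    (hP : ∀ j, a ≤ j → j ≤ b → z j ∈ P ∧ cellCard P (z j) ≤ 3)
    (hinj : Set.InjOn z (Set.Icc a b)) {i i' : Fin 2} (hi : ∀ j, j = i ∨ j = i') {k : ℤ}
    (hcol : ∀ j, a ≤ j → j ≤ b → cell (z j) i = k) :
    |cell (z a) i' - cell (z b) i'| ≤ 1 := by
  by_contra! h
  obtain ⟨m, s, h1, h2, h3⟩ := exists_crossing hab hstep h
  have hI : ∀ j ∈ Finset.Icc (s + 1) (s + 7), a ≤ j ∧ j ≤ b ∧ s < j ∧ j < s + 8 := by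
    intro j hj
    rw [Finset.mem_Icc] at hj
    omega
  have := card_le_of_cell_eq (P := P) (z := z) (I := Finset.Icc (s + 1) (s + 7)) (j₀ := s + 1)
    (fun j hj => (hP j (hI j hj).1 (hI j hj).2.1).1)
    (hinj.mono (by intro j hj; exact ⟨(hI j hj).1, (hI j hj).2.1⟩))
    (fun j hj => by
      obtain ⟨ha, hb, hc, hd⟩ := hI j hj
      ext l
      rcases hi l with rfl | rfl
      · rw [hcol j ha hb, hcol (s + 1) (by omega) (by omega)]
      · rw [h3 j hc hd, h3 (s + 1) (by omega) (by omega)])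
  have h4 := (hP (s + 1) (by omega) (by omega)).2
  simp at this
  omega

/-- A path whose interior points all lie in sparse cells has its ends in cells that touch. -/
theorem cellsTouch_of_sparse_sequence {P : Finset Plane} {z : ℕ → Plane} {a b : ℕ} (hab : a ≤ b)
    (hstep : ∀ j, a ≤ j → j < b → dist (z j) (z (j + 1)) ≤ 1)
    (hP : ∀ j, a < j → j < b → z j ∈ P ∧ cellCard P (z j) ≤ 3)
    (hinj : Set.InjOn z (Set.Ioo a b)) : CellsTouch (z a) (z b) := by
  classical
  intro i
  by_contra! h
  obtain ⟨m, s, h1, h2, h3⟩ := exists_crossing hab hstep h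
  obtain ⟨i', hi'⟩ := exists_other_coordinate i
  have hrow : ∀ j j', s < j → j ≤ j' → j' < s + 8 → |cell (z j) i' - cell (z j') i'| ≤ 1 := by
    intro j j' hj hjj hj'
    exact abs_cell_sub_le_one_of_column (P := P) hjj (fun l hl hl' => hstep l (by omega) (by omega))
      (fun l hl hl' => hP l (by omega) (by omega))
      (hinj.mono (by intro l hl; exact ⟨by have := hl.1; omega, by have := hl.2; omega⟩)) hi'
      (fun l hl hl' => h3 l (by omega) (by omega))
  have hrow' : ∀ j j', s < j → j < s + 8 → s < j' → j' < s + 8 →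
      cell (z j) i' ≤ cell (z j') i' + 1 := by
    intro j j' hj hj8 hj' hj8'
    rcases le_total j j' with hle | hle
    · linarith [(abs_le.1 (hrow j j' hj hle hj8')).2]
    · linarith [(abs_le.1 (hrow j' j hj' hle hj8)).1]
  -- Rows differ pairwise by at most one, so the seven points lie in the lowest row reached or the
  -- one above: two cells with at most three points each.
  obtain ⟨j₀, hj₀, hmin⟩ := (Finset.Icc (s + 1) (s + 7)).exists_min_image (fun j => cell (z j) i')
    ⟨s + 1, by simp⟩
  have hI : ∀ j ∈ Finset.Icc (s + 1) (s + 7), s < j ∧ j < s + 8 := by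
    intro j hj
    rw [Finset.mem_Icc] at hj
    omega
  have hpart : ∀ J ⊆ Finset.Icc (s + 1) (s + 7),
      (∀ j ∈ J, ∀ j' ∈ J, cell (z j) i' = cell (z j') i') → J.card ≤ 3 := by
    intro J hJ hJe
    rcases J.eq_empty_or_nonempty with rfl | ⟨l, hl⟩
    · simp
    refine (card_le_of_cell_eq (P := P) (z := z) (I := J) (j₀ := l) (fun j hj => ?_) ?_
      fun j hj => ?_).trans ?_
    · obtain ⟨h4, h5⟩ := hI j (hJ hj)
      exact (hP j (by omega) (by omega)).1
    · refine hinj.mono fun j hj => ?_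
      obtain ⟨h4, h5⟩ := hI j (hJ hj)
      exact ⟨by omega, by omega⟩
    · obtain ⟨h4, h5⟩ := hI j (hJ hj)
      obtain ⟨h6, h7⟩ := hI l (hJ hl)
      ext l'
      rcases hi' l' with rfl | rfl
      · rw [h3 j h4 h5, h3 l h6 h7]
      · exact hJe j hj l hl
    · obtain ⟨h6, h7⟩ := hI l (hJ hl)
      exact (hP l (by omega) (by omega)).2
  have hc := Finset.card_filter_add_card_filter_not (s := Finset.Icc (s + 1) (s + 7))
    (fun j => cell (z j) i' = cell (z j₀) i')
  have hc1 := hpart ((Finset.Icc (s + 1) (s + 7)).filter fun j => cell (z j) i' = cell (z j₀) i')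
    (Finset.filter_subset _ _) (by
      intro j hj j' hj'
      rw [(Finset.mem_filter.1 hj).2, (Finset.mem_filter.1 hj').2])
  have hc2 := hpart ((Finset.Icc (s + 1) (s + 7)).filter fun j => ¬cell (z j) i' = cell (z j₀) i')
    (Finset.filter_subset _ _) (by
      have : ∀ j ∈ (Finset.Icc (s + 1) (s + 7)).filter fun j => ¬cell (z j) i' = cell (z j₀) i',
          cell (z j) i' = cell (z j₀) i' + 1 := by
        intro j hj
        obtain ⟨hj, hne⟩ := Finset.mem_filter.1 hj
        have h4 := hmin j hj
        have h5 := hrow' j j₀ (hI j hj).1 (hI j hj).2 (hI _ hj₀).1 (hI _ hj₀).2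
        omega
      intro j hj j' hj'
      rw [this j hj, this j' hj'])
  simp only [Nat.card_Icc] at hc
  omega

/-- The points of `P` in cells with at most three points. -/
def sparsePoints (P : Set Plane) (F : Finset Plane) : Set P := {v | cellCard F v ≤ 3}

/-- Points within unit distance of a connected set of points in sparse cells lie in cells that
touch. -/
theorem cellsTouch_of_reachable_sparse {P : Set Plane} {F : Finset Plane} (hF : P ⊆ F)
    {t t' : sparsePoints P F}
    (h : ((unitDiskGraph P).induce (sparsePoints P F)).Reachable t t') {x y : Plane}
    (hx : dist x t ≤ 1) (hy : dist (t' : Plane) y ≤ 1) : CellsTouch x y := by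
  obtain ⟨w, hw⟩ := h.exists_isPath
  -- The path is padded with `x` and `y`, which shifts its indices by one. Sparsity and injectivity
  -- are needed only strictly between the ends, so `x` and `y` may lie in full cells or on the path.
  let z : ℕ → Plane := fun j =>
    if j = 0 then x else if j ≤ w.length + 1 then w.getVert (j - 1) else y
  have hz : ∀ j, j ≤ w.length → z (j + 1) = w.getVert j := by
    intro j hj
    simp [z, hj]
  have h0 : z 0 = x := by simp [z]
  have hl : z (w.length + 2) = y := by simp [z]
  have key := cellsTouch_of_sparse_sequence (P := F) (z := z) (a := 0) (b := w.length + 2)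
    (Nat.zero_le _) ?_ ?_ ?_
  · rwa [h0, hl] at key
  · rintro j - hj
    rcases Nat.eq_zero_or_pos j with rfl | hj0
    · rw [h0, hz 0 (Nat.zero_le _), SimpleGraph.Walk.getVert_zero]
      exact hx
    obtain ⟨j, rfl⟩ : ∃ l, j = l + 1 := ⟨j - 1, by omega⟩
    rcases Nat.lt_or_ge j w.length with hjl | hjl
    · rw [hz j hjl.le, hz (j + 1) hjl]
      exact (w.adj_getVert_succ hjl).2
    · obtain rfl : j = w.length := by omega
      rw [hz _ le_rfl, hl, SimpleGraph.Walk.getVert_length]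
      exact hy
  · intro j hj hj'
    obtain ⟨j, rfl⟩ : ∃ l, j = l + 1 := ⟨j - 1, by omega⟩
    rw [hz j (by omega)]
    exact ⟨hF (w.getVert j).1.2, (w.getVert j).2⟩
  · intro j hj j' hj' he
    obtain ⟨j, rfl⟩ : ∃ l, j = l + 1 := ⟨j - 1, by have := hj.1; omega⟩
    obtain ⟨j', rfl⟩ : ∃ l, j' = l + 1 := ⟨j' - 1, by have := hj'.1; omega⟩
    have h1 : j ≤ w.length := by have := hj.2; omega
    have h2 : j' ≤ w.length := by have := hj'.2; omega
    rw [hz j h1, hz j' h2] at he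
    rw [hw.getVert_injOn h1 h2 (Subtype.ext (Subtype.ext he))]

/-! ### Links within range and hop counts -/

/-- The pairs of facing antennas of `P` at distance at most `14 * √2`. -/
def linkGraph (P : Set Plane) (D : Plane → Plane) : SimpleGraph P where
  Adj u v := Facing D u v ∧ dist (u : Plane) (v : Plane) ≤ 14 * √2
  symm := ⟨fun _ _ h => ⟨h.1.symm, by rw [dist_comm]; exact h.2⟩⟩
  loopless := ⟨fun _ h => h.1.1 rfl⟩

theorem exists_linkGraph_le_symmCommGraph (P : Set Plane) {D : Plane → Plane}
    (hD : ∀ x, IsUnit2 (D x)) :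
    ∃ θ : P → ℝ, linkGraph P D ≤ symmCommGraph P (Real.pi / 2) (14 * √2) θ := by
  choose θ hθ using fun u : P => (hD u).exists_orientation
  refine ⟨θ, fun u v h => ⟨?_, hθ u _ _ _ h.1.2.1 h.2, hθ v _ _ _ h.1.2.2 ?_⟩⟩
  · rintro rfl
    exact h.1.1 rfl
  · rw [dist_comm]; exact h.2

/-- Reduces both claims to hop distances of facing pairs. Connectivity is inherited from the unit
disk graph, each edge of which is replaced by a path. -/
theorem exists_orientation_of_edist_le {P : Set Plane} (hconn : (unitDiskGraph P).Connected)
    {D : Plane → Plane} (hD : ∀ x, IsUnit2 (D x))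
    (h : ∀ u v, (unitDiskGraph P).Adj u v → (linkGraph P D).edist u v ≤ 8) :
    ∃ θ : P → ℝ,
      (symmCommGraph P (Real.pi / 2) (14 * √2) θ).Connected ∧
      IsHopSpanner (symmCommGraph P (Real.pi / 2) (14 * √2) θ) (unitDiskGraph P) 8 := by
  classical
  obtain ⟨θ, hθ⟩ := exists_linkGraph_le_symmCommGraph P hD
  have hspan : IsHopSpanner (symmCommGraph P (Real.pi / 2) (14 * √2) θ) (unitDiskGraph P) 8 := by
    intro u v huv
    have h8 := (SimpleGraph.edist_anti hθ).trans (h u v huv)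
    obtain ⟨w, hw⟩ := SimpleGraph.exists_walk_of_edist_ne_top
      (ne_top_of_le_ne_top (ENat.natCast_ne_top 8) h8)
    refine ⟨w.bypass, w.bypass_isPath, w.length_bypass_le_length.trans ?_⟩
    rw [← hw] at h8
    exact_mod_cast h8
  have := hconn.nonempty
  refine ⟨θ, ⟨fun u v => ?_⟩, hspan⟩
  obtain ⟨w⟩ := hconn.preconnected u v
  induction w with
  | nil => exact SimpleGraph.Reachable.refl _
  | cons hadj _ ih =>
    obtain ⟨w, -⟩ := hspan _ _ hadj
    exact w.reachable.trans ih

theorem edist_le_add {V : Type*} {G : SimpleGraph V} {u v w : V} {m n k : ℕ}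
    (h : G.edist u v ≤ m) (h' : G.edist v w ≤ n) (hk : m + n ≤ k := by norm_num) :
    G.edist u w ≤ k :=
  SimpleGraph.edist_triangle.trans ((add_le_add h h').trans (by exact_mod_cast hk))

/-- On the path c-b-a-d both middle vertices are within two hops of all four, and `p` is within one
hop of a middle vertex. -/
theorem edist_le_three {V : Type*} {G : SimpleGraph V} {a b c d p q : V} (hab : G.Adj a b)
    (had : G.Adj a d) (hbc : G.Adj b c)
    (hp : (p = a ∨ p = b ∨ p = c ∨ p = d) ∨ G.Adj p a ∨ G.Adj p b)
    (hq : q = a ∨ q = b ∨ q = c ∨ q = d) : G.edist p q ≤ (3 : ℕ) := by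
  have one : ∀ {u v}, G.Adj u v → G.edist u v ≤ (1 : ℕ) := fun h =>
    SimpleGraph.edist_le_one_iff_adj_or_eq.2 (Or.inl h)
  have zero : ∀ u, G.edist u u ≤ (0 : ℕ) := fun u => by simp
  have hpr : G.edist p a ≤ (1 : ℕ) ∨ G.edist p b ≤ (1 : ℕ) := by
    rcases hp with (rfl | rfl | rfl | rfl) | h | h
    · exact Or.inl ((zero _).trans (by simp))
    · exact Or.inr ((zero _).trans (by simp))
    · exact Or.inr (one hbc.symm)
    · exact Or.inl (one had.symm)
    · exact Or.inl (one h)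
    · exact Or.inr (one h)
  have ha : G.edist a q ≤ (2 : ℕ) := by
    rcases hq with rfl | rfl | rfl | rfl
    · exact (zero _).trans (by simp)
    · exact edist_le_add (one hab) (zero _)
    · exact edist_le_add (one hab) (one hbc)
    · exact edist_le_add (one had) (zero _)
  have hb : G.edist b q ≤ (2 : ℕ) := by
    rcases hq with rfl | rfl | rfl | rfl
    · exact edist_le_add (one hab.symm) (zero _)
    · exact (zero _).trans (by simp)
    · exact edist_le_add (one hbc) (zero _)
    · exact edist_le_add (one hab.symm) (one had)
  rcases hpr with h | h
  · exact edist_le_add h ha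
  · exact edist_le_add h hb

theorem IsHub.edist_le {P S : Set Plane} {D : Plane → Plane} {a b c d : Plane}
    (h : IsHub S D a b c d) (hSP : S ⊆ P) (hdist : ∀ u ∈ S, ∀ v ∈ S, dist u v ≤ 14 * √2)
    {p q : P} (hp : (p : Plane) ∈ S) (hq : (q : Plane) ∈ ({a, b, c, d} : Set Plane)) :
    (linkGraph P D).edist p q ≤ (3 : ℕ) := by
  have haS : a ∈ S := h.subset (by simp)
  have hbS : b ∈ S := h.subset (by simp)
  have hcS : c ∈ S := h.subset (by simp)
  have hdS : d ∈ S := h.subset (by simp)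
  have mem : ∀ {r : P}, (r : Plane) ∈ ({a, b, c, d} : Set Plane) →
      r = ⟨a, hSP haS⟩ ∨ r = ⟨b, hSP hbS⟩ ∨ r = ⟨c, hSP hcS⟩ ∨ r = ⟨d, hSP hdS⟩ := by
    intro r hr
    simp only [Set.mem_insert_iff, Set.mem_singleton_iff] at hr
    exact hr.imp Subtype.ext (Or.imp Subtype.ext (Or.imp Subtype.ext Subtype.ext))
  refine edist_le_three (G := linkGraph P D) (a := ⟨a, hSP haS⟩) (b := ⟨b, hSP hbS⟩) (c := ⟨c, hSP hcS⟩)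
    (d := ⟨d, hSP hdS⟩) ⟨h.facing_ab, hdist _ haS _ hbS⟩ ⟨h.facing_ad, hdist _ haS _ hdS⟩
    ⟨h.facing_bc, hdist _ hbS _ hcS⟩ ?_ ?_
  · rcases h.attached p hp with h | h | h
    · exact Or.inl (mem h)
    · exact Or.inr (Or.inl ⟨h, hdist _ hp _ haS⟩)
    · exact Or.inr (Or.inr ⟨h, hdist _ hp _ hbS⟩)
  · exact mem hq

theorem Facing.congr {D D' : Plane → Plane} {u v : Plane} (h : Facing D u v)
    (hu : D u = D' u) (hv : D v = D' v) : Facing D' u v := by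
  rw [Facing, ← hu, ← hv]; exact h

/-- Lets the directions chosen separately in each cell be glued into one global assignment. -/
theorem IsHub.congr {S : Set Plane} {D D' : Plane → Plane} {a b c d : Plane}
    (h : IsHub S D a b c d) (hD : ∀ p ∈ S, D p = D' p) : IsHub S D' a b c d := by
  have ha := hD a (h.subset (by simp))
  have hb := hD b (h.subset (by simp))
  have hc := hD c (h.subset (by simp))
  have hd := hD d (h.subset (by simp))
  have hcov : ∀ {o e}, CoversFrom D {a, b, c, d} o e → CoversFrom D' {a, b, c, d} o e := by
    rintro o e ⟨p, hp, hpe, hw⟩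
    exact ⟨p, hp, by rw [← hD p (h.subset hp), hpe], hw⟩
  refine ⟨h.subset, h.facing_ab.congr ha hb, h.facing_ad.congr ha hd, h.facing_bc.congr hb hc,
    fun p hp => ?_, ?_⟩
  · rcases h.attached p hp with h' | h' | h'
    · exact Or.inl h'
    · exact Or.inr (Or.inl (h'.congr (hD p hp) ha))
    · exact Or.inr (Or.inr (h'.congr (hD p hp) hb))
  · obtain ⟨o, e, h0, h1, h2, h3⟩ := h.isCenter
    exact ⟨o, e, hcov h0, hcov h1, hcov h2, hcov h3⟩

/-! ### Assembling the directions -/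

/-- Distinct cells are separated by a line. -/
theorem exists_separator {x y : Plane} (h : cell x ≠ cell y) :
    ∃ n : Plane, ∀ p q, cell p = cell x → cell q = cell y →
      0 < n 0 * (q 0 - p 0) + n 1 * (q 1 - p 1) := by
  have key : ∀ {p q : Plane} {i : Fin 2}, cell p i < cell q i → p i < q i := by
    intro p q i h
    exact (cell_lt.1 h).trans_le (le_cell.1 le_rfl)
  obtain ⟨i, hi⟩ := Function.ne_iff.1 h
  rcases lt_or_gt_of_ne hi with hi | hi
  · have hpq : ∀ p q, cell p = cell x → cell q = cell y → p i < q i := fun p q hp hq =>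
      key (by rwa [hp, hq])
    fin_cases i
    · exact ⟨!₂[1, 0], fun p q hp hq => by simpa using hpq p q hp hq⟩
    · exact ⟨!₂[0, 1], fun p q hp hq => by simpa using hpq p q hp hq⟩
  · have hpq : ∀ p q, cell p = cell x → cell q = cell y → q i < p i := fun p q hp hq =>
      key (by rwa [hp, hq])
    fin_cases i
    · exact ⟨!₂[-1, 0], fun p q hp hq => by simpa using hpq p q hp hq⟩
    · exact ⟨!₂[0, -1], fun p q hp hq => by simpa using hpq p q hp hq⟩

theorem Finset.exists_eq_triple {α : Type*} [DecidableEq α] {s : Finset α} (hs : s.Nonempty)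
    (h : s.card ≤ 3) : ∃ a b c, s = {a, b, c} := by
  have hpos := hs.card_pos
  obtain h | h | h : s.card = 1 ∨ s.card = 2 ∨ s.card = 3 := by omega
  · obtain ⟨a, rfl⟩ := Finset.card_eq_one.1 h
    exact ⟨a, a, a, by simp⟩
  · obtain ⟨a, b, -, rfl⟩ := Finset.card_eq_two.1 h
    exact ⟨a, b, b, by simp⟩
  · obtain ⟨a, b, c, -, -, -, rfl⟩ := Finset.card_eq_three.1 h
    exact ⟨a, b, c, rfl⟩

/-- A set of diameter at most `14 * √2` can be oriented with hop diameter at most `8`. -/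
theorem exists_directions_of_dist_le {P : Set Plane} {F : Finset Plane} (hF : P = F)
    (hne : F.Nonempty) (hdist : ∀ u ∈ P, ∀ v ∈ P, dist u v ≤ 14 * √2) :
    ∃ D : Plane → Plane, (∀ x, IsUnit2 (D x)) ∧ ∀ u v, (linkGraph P D).edist u v ≤ 8 := by
  classical
  rcases Nat.lt_or_ge F.card 4 with hc | hc
  · obtain ⟨x, y, z, rfl⟩ := Finset.exists_eq_triple hne (by omega)
    obtain ⟨D, a, hD, ha, hstar⟩ := exists_star x y z
    have hP : P = {x, y, z} := by simp [hF]
    refine ⟨D, hD, fun u v => ?_⟩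
    have key : ∀ u : P, (linkGraph P D).edist u ⟨a, hP ▸ ha⟩ ≤ (1 : ℕ) := by
      intro u
      refine SimpleGraph.edist_le_one_iff_adj_or_eq.2 ?_
      rcases hstar u (hP ▸ u.2) with h | h
      · exact Or.inr (Subtype.ext h)
      · exact Or.inl ⟨h, hdist _ u.2 _ (hP ▸ ha)⟩
    exact edist_le_add (key u) (by rw [SimpleGraph.edist_comm]; exact key v) (k := 8)
  · obtain ⟨D, a, b, c, d, hD, hhub⟩ := exists_isHub hc
    rw [← hF] at hhub
    refine ⟨D, hD, fun u v => ?_⟩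
    have key : ∀ u : P, (linkGraph P D).edist u ⟨a, hhub.subset (by simp)⟩ ≤ (3 : ℕ) := fun u =>
      hhub.edist_le subset_rfl hdist u.2 (by simp)
    exact edist_le_add (key u) (by rw [SimpleGraph.edist_comm]; exact key v) (k := 8)

/-- Every connected set of points in sparse cells has a point adjacent to a point of a full
cell, if there is any. -/
theorem exists_full_neighbor {P : Set Plane} {F : Finset Plane}
    (hconn : (unitDiskGraph P).Connected) {y : P} (hy : ¬cellCard F y ≤ 3)
    (T : ((unitDiskGraph P).induce (sparsePoints P F)).ConnectedComponent) :
    ∃ (t : sparsePoints P F) (x : P),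
      ((unitDiskGraph P).induce (sparsePoints P F)).connectedComponentMk t = T ∧
      dist (x : Plane) t ≤ 1 ∧ ¬cellCard F x ≤ 3 := by
  induction T using SimpleGraph.ConnectedComponent.ind with
  | _ t₀ =>
  obtain ⟨w⟩ := hconn.preconnected t₀.1 y
  -- A walk to the full cell leaves the component along some edge; were the head of that edge
  -- sparse, it would belong to the component too.
  obtain ⟨d, -, ⟨h, hfst⟩, hsnd⟩ := w.exists_boundary_dart
    {v | ∃ h : v ∈ sparsePoints P F,
      ((unitDiskGraph P).induce (sparsePoints P F)).Reachable ⟨v, h⟩ t₀}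
    ⟨t₀.2, SimpleGraph.Reachable.refl _⟩ (fun ⟨h, _⟩ => hy h)
  refine ⟨⟨d.fst, h⟩, d.snd, SimpleGraph.ConnectedComponent.sound hfst, ?_, fun hx => ?_⟩
  · rw [dist_comm]; exact d.adj.2
  · refine hsnd ⟨hx, ?_⟩
    have hadj : ((unitDiskGraph P).induce (sparsePoints P F)).Adj ⟨d.snd, hx⟩ ⟨d.fst, h⟩ :=
      d.adj.symm
    exact hadj.reachable.trans hfst

open Classical in
/-- The points of `F` in the cell of `x`. -/
noncomputable def cellPoints (F : Finset Plane) (x : Plane) : Finset Plane :=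
  F.filter fun y => cell y = cell x

theorem mem_cellPoints {F : Finset Plane} {x y : Plane} :
    y ∈ cellPoints F x ↔ y ∈ F ∧ cell y = cell x := by simp [cellPoints]

theorem cellPoints_congr {F : Finset Plane} {x y : Plane} (h : cell y = cell x) :
    cellPoints F y = cellPoints F x := by simp [cellPoints, h]

/-- Directions for a connected unit disk graph having a full cell. -/
theorem exists_directions_of_full_cell {P : Set Plane} {F : Finset Plane} (hF : P = F)
    (hconn : (unitDiskGraph P).Connected) {y : P} (hy : ¬cellCard F y ≤ 3) :
    ∃ D : Plane → Plane, (∀ x, IsUnit2 (D x)) ∧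
      ∀ u v, (unitDiskGraph P).Adj u v → (linkGraph P D).edist u v ≤ 8 := by
  classical
  -- The hub is chosen as a function of the set of points in a cell, so that all points of the cell
  -- agree on it.
  choose! E a b c d hE hhub using fun S : Finset Plane => exists_isHub (S := S)
  choose f hf hfw using exists_isUnit2_wedge
  choose t x htT hx hfull using exists_full_neighbor hconn hy
  have hcard : ∀ {p : Plane}, ¬cellCard F p ≤ 3 → 4 ≤ (cellPoints F p).card := fun h =>
    not_le.1 h
  let Q : Plane → Set Plane := fun p =>
    {a (cellPoints F p), b (cellPoints F p), c (cellPoints F p), d (cellPoints F p)}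
  have htarget : ∀ p : sparsePoints P F,
      ∃ q ∈ Q (x (SimpleGraph.connectedComponentMk _ p)),
        Wedge (E (cellPoints F (x (SimpleGraph.connectedComponentMk _ p))) q) (p - q) := by
    intro p
    obtain ⟨o, e, h⟩ := (hhub _ (hcard (hfull (SimpleGraph.connectedComponentMk _ p)))).isCenter
    exact h.exists_covers (hE _ (hcard (hfull _))) p
  choose q hq hqw using htarget
  -- Sparse points aim at their target `q`, and full cells use their hub directions. The default `f
  -- 0` is reached only outside `P`.
  let D : Plane → Plane := fun p =>
    if h : ∃ hp : p ∈ P, (⟨p, hp⟩ : P) ∈ sparsePoints P F then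
      f (q ⟨⟨p, h.1⟩, h.2⟩ - p) else
    if 4 ≤ (cellPoints F p).card then E (cellPoints F p) p else f 0
  have hD : ∀ p, IsUnit2 (D p) := by
    intro p
    simp only [D]
    split_ifs with h1 h2
    exacts [hf _, hE _ h2 _, hf _]
  have hDfull : ∀ p, ¬cellCard F p ≤ 3 → D p = E (cellPoints F p) p := by
    intro p hp
    have h1 : ¬∃ hp : p ∈ P, (⟨p, hp⟩ : P) ∈ sparsePoints P F := fun ⟨_, h⟩ => hp h
    simp only [D, dif_neg h1, if_pos (hcard hp)]
  have hDsparse : ∀ p : sparsePoints P F, D p = f (q p - p) := by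
    intro p
    have h1 : ∃ hp : (p : Plane) ∈ P, (⟨p, hp⟩ : P) ∈ sparsePoints P F := ⟨p.1.2, p.2⟩
    simp only [D, dif_pos h1]
  have hDcell : ∀ p, ¬cellCard F p ≤ 3 → ∀ p' ∈ cellPoints F p, E (cellPoints F p) p' = D p' := by
    intro p hp p' hp'
    have h := cellPoints_congr (F := F) (mem_cellPoints.1 hp').2
    have hp'' : ¬cellCard F p' ≤ 3 := by
      show ¬(cellPoints F p').card ≤ 3
      rw [h]; exact hp
    rw [hDfull p' hp'', h]
  have hub : ∀ p, ¬cellCard F p ≤ 3 → IsHub (cellPoints F p) D (a (cellPoints F p))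
      (b (cellPoints F p)) (c (cellPoints F p)) (d (cellPoints F p)) := fun p hp =>
    (hhub _ (hcard hp)).congr (hDcell p hp)
  have hQ : ∀ {p}, ¬cellCard F p ≤ 3 → ∀ r ∈ Q p, r ∈ P ∧ cell r = cell p := by
    intro p hp r hr
    have := mem_cellPoints.1 ((hub p hp).subset hr)
    exact ⟨hF ▸ this.1, this.2⟩
  have hfull3 : ∀ {p : Plane}, ¬cellCard F p ≤ 3 → ∀ u v : P, cell u = cell p →
      (v : Plane) ∈ Q p → (linkGraph P D).edist u v ≤ (3 : ℕ) := by
    intro p hp u v hu hv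
    refine (hub p hp).edist_le (P := P) ?_ ?_ (mem_cellPoints.2 ⟨?_, hu⟩) hv
    · intro r hr
      rw [hF]; exact (mem_cellPoints.1 hr).1
    · intro r hr s hs
      apply CellsTouch.dist_le
      intro i
      rw [(mem_cellPoints.1 hr).2, (mem_cellPoints.1 hs).2]
      simp
    · exact hF.subset u.2
  have hsparse4 : ∀ (p : sparsePoints P F) (v : P),
      (v : Plane) ∈ Q (x (SimpleGraph.connectedComponentMk _ p)) →
      (linkGraph P D).edist p.1 v ≤ (4 : ℕ) := by
    intro p v hv
    have hfx := hfull (SimpleGraph.connectedComponentMk _ p)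
    obtain ⟨hqP, hqc⟩ := hQ hfx _ (hq p)
    have htouch : CellsTouch (x (SimpleGraph.connectedComponentMk _ p)) p :=
      cellsTouch_of_reachable_sparse hF.le
        (SimpleGraph.ConnectedComponent.exact (htT (SimpleGraph.connectedComponentMk _ p)))
        (hx _) (by simp)
    have hne : (p : Plane) ≠ q p := by
      intro h
      have h1 : ¬cellCard F (q p) ≤ 3 := by
        show ¬(cellPoints F (q p)).card ≤ 3
        rw [cellPoints_congr hqc]; exact hfx
      rw [← h] at h1
      exact h1 p.2
    have hadj : (linkGraph P D).Adj p.1 ⟨q p, hqP⟩ := by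
      refine ⟨⟨hne, ?_, ?_⟩, (htouch.symm.of_cell_eq rfl hqc).dist_le⟩
      · rw [hDsparse]; exact hfw _
      · have := hDcell _ hfx (q p) ((hub _ hfx).subset (hq p))
        dsimp only
        rw [← this]; exact hqw p
    exact edist_le_add (SimpleGraph.edist_le_one_iff_adj_or_eq.2 (Or.inl hadj))
      (hfull3 hfx _ v hqc hv)
  have hlink : ∀ {p p' : Plane}, ¬cellCard F p ≤ 3 → ¬cellCard F p' ≤ 3 → CellsTouch p p' →
      ∃ r r' : P, (r : Plane) ∈ Q p ∧ (r' : Plane) ∈ Q p' ∧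
        (linkGraph P D).edist r r' ≤ (1 : ℕ) := by
    intro p p' hp hp' htouch
    by_cases hc : cell p = cell p'
    · have hr : a (cellPoints F p) ∈ Q p := by simp [Q]
      refine ⟨⟨_, (hQ hp _ hr).1⟩, ⟨_, (hQ hp _ hr).1⟩, hr, ?_, by simp⟩
      simp only [Q, ← cellPoints_congr hc]
      simp
    · obtain ⟨n, hn⟩ := exists_separator hc
      obtain ⟨o, e, ho⟩ := (hub p hp).isCenter
      obtain ⟨o', e', ho'⟩ := (hub p' hp').isCenter
      obtain ⟨r, hr, r', hr', hw, hw'⟩ := ho.exists_facing ho' hD n (fun r hr r' hr' =>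
        hn r r' (hQ hp r hr).2 (hQ hp' r' hr').2)
      obtain ⟨hrP, hrc⟩ := hQ hp r hr
      obtain ⟨hrP', hrc'⟩ := hQ hp' r' hr'
      refine ⟨⟨r, hrP⟩, ⟨r', hrP'⟩, hr, hr',
        SimpleGraph.edist_le_one_iff_adj_or_eq.2 (Or.inl ⟨⟨?_, hw, hw'⟩, ?_⟩)⟩
      · rintro rfl
        exact hc (hrc.symm.trans hrc')
      · exact (htouch.of_cell_eq hrc hrc').dist_le
  have hmixed : ∀ (p : sparsePoints P F) (v : P), ¬cellCard F v ≤ 3 →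
      (unitDiskGraph P).Adj p.1 v → (linkGraph P D).edist p.1 v ≤ (8 : ℕ) := by
    intro p v hv hadj
    -- `v` and the chosen full neighbor are both within unit distance of the same sparse component.
    have htouch : CellsTouch (x (SimpleGraph.connectedComponentMk _ p)) v :=
      cellsTouch_of_reachable_sparse hF.le
        (SimpleGraph.ConnectedComponent.exact (htT (SimpleGraph.connectedComponentMk _ p)))
        (hx _) hadj.2
    obtain ⟨r, r', hr, hr', hrr⟩ := hlink (hfull _) hv htouch
    exact edist_le_add (edist_le_add (hsparse4 p r hr) hrr (k := 5))
      (by rw [SimpleGraph.edist_comm]; exact hfull3 hv v r' rfl hr')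
  refine ⟨D, hD, fun u v hadj => ?_⟩
  by_cases hu : cellCard F u ≤ 3 <;> by_cases hv : cellCard F v ≤ 3
  · have hcomp : SimpleGraph.connectedComponentMk
        ((unitDiskGraph P).induce (sparsePoints P F)) ⟨u, hu⟩ =
        SimpleGraph.connectedComponentMk _ ⟨v, hv⟩ := by
      apply SimpleGraph.ConnectedComponent.sound
      apply SimpleGraph.Adj.reachable
      exact hadj
    have hr : a (cellPoints F (x (SimpleGraph.connectedComponentMk _ ⟨u, hu⟩))) ∈
      Q (x (SimpleGraph.connectedComponentMk _ ⟨u, hu⟩)) := by simp [Q]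
    have h1 := hsparse4 ⟨u, hu⟩ ⟨_, (hQ (hfull _) _ hr).1⟩ hr
    have h2 := hsparse4 ⟨v, hv⟩ ⟨_, (hQ (hfull _) _ hr).1⟩ (by rw [← hcomp]; exact hr)
    rw [SimpleGraph.edist_comm] at h2
    exact edist_le_add h1 h2 (k := 8)
  · exact hmixed ⟨u, hu⟩ v hv hadj
  · rw [SimpleGraph.edist_comm]
    exact hmixed ⟨v, hv⟩ u hu hadj.symm
  · obtain ⟨r, r', hr, hr', hrr⟩ := hlink hu hv (cellsTouch_of_dist_le_one hadj.2)
    exact edist_le_add (edist_le_add (hfull3 hu u r rfl hr) hrr (k := 4))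
      (by rw [SimpleGraph.edist_comm]; exact hfull3 hv v r' rfl hr') (k := 8)

theorem theorem3 (P : Set Plane) (hfin : P.Finite) (hconn : (unitDiskGraph P).Connected) :
    ∃ θ : P → ℝ,
      (symmCommGraph P (Real.pi / 2) (14 * Real.sqrt 2) θ).Connected ∧
      IsHopSpanner (symmCommGraph P (Real.pi / 2) (14 * Real.sqrt 2) θ) (unitDiskGraph P) 8 := by
  have hF : P = hfin.toFinset := by simp
  by_cases h : ∃ y : P, ¬cellCard hfin.toFinset y ≤ 3
  · obtain ⟨y, hy⟩ := h
    obtain ⟨D, hD, hedist⟩ := exists_directions_of_full_cell hF hconn hy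
    exact exists_orientation_of_edist_le hconn hD hedist
  · push Not at h
    obtain ⟨⟨p, hp⟩⟩ := hconn.nonempty
    -- With no full cell the sparse subgraph is the whole graph, so any two points of `P` lie in
    -- touching cells.
    let φ : unitDiskGraph P →g (unitDiskGraph P).induce (sparsePoints P hfin.toFinset) :=
      ⟨fun v => ⟨v, h v⟩, fun hadj => hadj⟩
    obtain ⟨D, hD, hedist⟩ := exists_directions_of_dist_le hF ⟨p, by simpa using hp⟩
      (fun u hu v hv => (cellsTouch_of_reachable_sparse hF.le
        ((hconn.preconnected ⟨u, hu⟩ ⟨v, hv⟩).map φ) (x := u) (y := v)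
        (by show dist u u ≤ 1; simp) (by show dist v v ≤ 1; simp)).dist_le)
    exact exists_orientation_of_edist_le hconn hD fun u v _ => hedist u v
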